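/- Let $S$ be a nonempty semigroup. A term over $S$ in variables $x_1,\dots,x_n$ is a nonempty finite product of variables and elements of $S$; an equation is an equality of two terms; a subset of $S^n$ is algebraic if it is the solution set of an arbitrary (possibly infinite) set of equations in $x_1,\dots,x_n$. The semigroup $S$ is an equational domain if for every $n$ the union $Y_1\cup\dots\cup Y_k$ ($k\ge 1$) of any finitely many algebraic subsets of $S^n$ is algebraic, and a proper equational domain if moreover $S$ is not a group. If a nonempty semigroup $S$ is a proper equational domain, then $|S|\ge 240$. The bound is sharp: let $g\neq 1$ be any element of the alternating group $A_5$ (such $g$ exists), let $p_{11}=p_{12}=p_{21}=1$ and $p_{22}=g$, and let $S_{240}$ be the set of triples $(\lambda,h,i)$ with $\lambda,i\in\{1,2\}$, $h\in A_5$, with the multiplication $(\lambda,h,i)(\mu,h',j)=(\lambda,h\,p_{i\mu}\,h',j)$. Then $S_{240}$ is a proper equational domain and $|S_{240}|=240$. -/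

import Mathlib

namespace SemigroupGeometry

/-- Terms in the variables `x_1, …, x_n` over the language of semigroups extended by a constant for
every element of `S`: nonempty finite products (words) of variables and constants. -/
abbrev Term (S : Type*) (n : ℕ) : Type _ := FreeSemigroup (Fin n ⊕ S)

/-- The value of a term at the point `p` of `S ^ n`. -/
def Term.eval {S : Type*} [Semigroup S] {n : ℕ} (p : Fin n → S) (t : Term S n) : S :=
  FreeSemigroup.lift (Sum.elim p id) t

/-- The solution set in `S ^ n` of a system, that is, of an arbitrary set of equations `t = s`
(written as pairs of terms). -/
def solutionSet {S : Type*} [Semigroup S] {n : ℕ} (E : Set (Term S n × Term S n)) :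
    Set (Fin n → S) :=
  {p | ∀ e ∈ E, Term.eval p e.1 = Term.eval p e.2}

/-- A subset of `S ^ n` is algebraic if it is the solution set of some system. -/
def IsAlgebraicSet {S : Type*} [Semigroup S] {n : ℕ} (Y : Set (Fin n → S)) : Prop :=
  ∃ E : Set (Term S n × Term S n), solutionSet E = Y

/-- `S` is an equational domain if every union `Y_0 ∪ … ∪ Y_k` of (finitely many, at least one)
algebraic sets in the same affine space `S ^ n` is algebraic. -/
def IsEquationalDomain (S : Type*) [Semigroup S] : Prop :=
  ∀ (n k : ℕ) (Y : Fin (k + 1) → Set (Fin n → S)),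
    (∀ i, IsAlgebraicSet (Y i)) → IsAlgebraicSet (⋃ i, Y i)

/-- The multiplication of `S` is that of a group. -/
def IsGroup (S : Type*) [Semigroup S] : Prop :=
  ∃ e : S, (∀ x : S, e * x = x ∧ x * e = x) ∧ ∀ x : S, ∃ y : S, x * y = e ∧ y * x = e

/-- A proper equational domain is one that is not a group. -/
def IsProperEquationalDomain (S : Type*) [Semigroup S] : Prop :=
  IsEquationalDomain S ∧ ¬ IsGroup S

/-- The underlying set `Λ × G × I` of the Rees matrix semigroup `(G, P, Λ, I)`; the sandwich matrix
`P` has rows indexed by `I` and columns indexed by `Λ`. -/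
@[ext]
structure ReesMatrix {G Λ I : Type*} (P : Matrix I Λ G) where
  first : Λ
  elt : G
  second : I

/-- `(a, g, i) (b, h, j) = (a, g * P i b * h, j)`. -/
instance {G Λ I : Type*} [Group G] (P : Matrix I Λ G) : Semigroup (ReesMatrix P) where
  mul x y := ⟨x.first, x.elt * P x.second y.first * y.elt, y.second⟩
  mul_assoc x y z := ReesMatrix.ext rfl
    (show x.elt * P x.second y.first * y.elt * P y.second z.first * z.elt =
      x.elt * P x.second y.first * (y.elt * P y.second z.first * z.elt) by
        simp only [mul_assoc]) rfl

/-- The Rees matrix semigroup over the alternating group `A_5` with two indices on either side and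
sandwich matrix `(1, 1; 1, g)`. -/
abbrev S240 (g : alternatingGroup (Fin 5)) : Type :=
  ReesMatrix (!![1, 1; 1, g] : Matrix (Fin 2) (Fin 2) (alternatingGroup (Fin 5)))

end SemigroupGeometry

/-!
A semigroup is an equational domain exactly when the single set `x_0 = x_1 ∨ x_2 = x_3` in `S ^ 4`
is algebraic, since equations for it can be turned into equations for any union of two algebraic
sets by substitution. In other words, every point off this set must violate an equation that holds
on it (`SeparatesDisjunction`). Both halves of the theorem are about this condition.

For the lower bound let `S` be a finite equational domain that is not a group, and let `K` be its
minimal ideal, `e` an idempotent of `K` and `G = e S e`, which is a group. Three kinds of points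
cannot be separated from the disjunction:

* points `(e, f, e, f)` where `e ≠ f` in `K` multiply `K` alike from one side
  (`SeparatesDisjunction.eq_of_forall_mul_eq` and its mirror image);
* points `(a, a * e, a, a * e)` with `a ∉ K`, if `e` is an identity element of `K`
  (`SeparatesDisjunction.mem_of_ideal_identity`);
* points `(a, 1, a, 1)` with `a ≠ 1` in an abelian normal subgroup of `G`
  (`SeparatesDisjunction.eq_bot_of_normal_abelian`).

If `K` were a single `ℛ`-class or a single `ℒ`-class, the first fact would make `e` an identity
element of `K`, and the second would give `S = K = G`, a group. Hence `K` has at least two classes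
of each kind and contains four disjoint copies of `G` (`four_mul_card_localGroup_le`). By the
first fact `G` is nontrivial, and by the third it has no nontrivial abelian normal subgroup, so it
is not solvable. Groups of order less than sixty are solvable (`isSolvable_of_card_lt_sixty`), by
Sylow counting and Burnside's transfer theorem. So `|S| ≥ 4 * 60`.

For sharpness, in the simple group `A_5` any two nontrivial elements have noncommuting conjugates,
so over `A_5` the condition "`a = 1` or `b = 1`" is a system of commutator equations. The sandwich
matrix `(1, 1; 1, g)` has distinct rows and distinct columns, so translations of `S_240` into its
local group distinguish points, and the system transfers to the semigroup
(`ReesMatrix.isEquationalDomain`).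
-/

namespace SemigroupGeometry

/-! ### Values of terms -/

section Terms

variable {S : Type*} [Semigroup S] {n : ℕ}

@[simp]
theorem Term.eval_of (p : Fin n → S) (x : Fin n ⊕ S) :
    Term.eval p (FreeSemigroup.of x) = Sum.elim p id x := by
  simp [Term.eval]

@[simp]
theorem Term.eval_mul (p : Fin n → S) (t s : Term S n) :
    Term.eval p (t * s) = Term.eval p t * Term.eval p s := by
  simp [Term.eval]

/-- Substituting terms for the variables of a term. -/
def Term.subst {m : ℕ} (σ : Fin m → Term S n) : Term S m →ₙ* Term S n :=
  FreeSemigroup.lift (Sum.elim σ fun c => FreeSemigroup.of (Sum.inr c))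

theorem Term.eval_subst {m : ℕ} (σ : Fin m → Term S n) (p : Fin n → S) (t : Term S m) :
    Term.eval p (Term.subst σ t) = Term.eval (fun i => Term.eval p (σ i)) t := by
  induction t using FreeSemigroup.recOnMul with
  | ih1 x => cases x <;> simp [Term.subst]
  | ih2 x y hx hy => simp_all [map_mul]

/-- Reading terms backwards: the terms of `S` and of its opposite semigroup have the same values. -/
theorem Term.exists_eval_op (t : Term S n) :
    ∃ t' : Term Sᵐᵒᵖ n, ∀ p : Fin n → S,
      Term.eval (fun i => MulOpposite.op (p i)) t' = MulOpposite.op (Term.eval p t) := by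
  induction t using FreeSemigroup.recOnMul with
  | ih1 x =>
    cases x with
    | inl i => exact ⟨FreeSemigroup.of (Sum.inl i), by simp⟩
    | inr c => exact ⟨FreeSemigroup.of (Sum.inr (MulOpposite.op c)), by simp⟩
  | ih2 x y hx hy =>
    obtain ⟨x', hx⟩ := hx
    obtain ⟨y', hy⟩ := hy
    exact ⟨y' * x', fun p => by simp [hx, hy]⟩

/-- Membership in the set `x_0 = x_1 ∨ x_2 = x_3`, whose algebraicity characterises equational
domains. -/
def InDisjunction (p : Fin 4 → S) : Prop := p 0 = p 1 ∨ p 2 = p 3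

variable (S) in
/-- Every point outside `x_0 = x_1 ∨ x_2 = x_3` violates an equation valid on that set. The
condition is phrased contrapositively. -/
def SeparatesDisjunction : Prop :=
  ∀ p : Fin 4 → S, (∀ t s : Term S 4, (∀ q, InDisjunction q → Term.eval q t = Term.eval q s) →
    Term.eval p t = Term.eval p s) → InDisjunction p

theorem IsEquationalDomain.separatesDisjunction (h : IsEquationalDomain S) :
    SeparatesDisjunction S := by
  intro p hp
  let E : Fin 2 → Set (Term S 4 × Term S 4) :=
    ![{(FreeSemigroup.of (Sum.inl 0), FreeSemigroup.of (Sum.inl 1))},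
      {(FreeSemigroup.of (Sum.inl 2), FreeSemigroup.of (Sum.inl 3))}]
  have hE : ∀ q : Fin 4 → S, q ∈ ⋃ i, solutionSet (E i) ↔ InDisjunction q := by
    intro q
    simp [Fin.exists_fin_two, E, solutionSet, InDisjunction]
  obtain ⟨F, hF⟩ := h 4 1 (fun i => solutionSet (E i)) fun i => ⟨E i, rfl⟩
  rw [← hE, ← hF]
  intro e he
  refine hp e.1 e.2 fun q hq => ?_
  rw [← hE, ← hF] at hq
  exact hq e he

/-- A union of two algebraic sets is cut out by substituting both sides of an equation of the first
and of an equation of the second into the equations of `x_0 = x_1 ∨ x_2 = x_3`. -/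
theorem SeparatesDisjunction.isAlgebraicSet_union (h : SeparatesDisjunction S)
    {Y Z : Set (Fin n → S)} (hY : IsAlgebraicSet Y) (hZ : IsAlgebraicSet Z) :
    IsAlgebraicSet (Y ∪ Z) := by
  obtain ⟨E, rfl⟩ := hY
  obtain ⟨F, rfl⟩ := hZ
  let σ (e f : Term S n × Term S n) : Fin 4 → Term S n := ![e.1, e.2, f.1, f.2]
  refine ⟨{d | ∃ e ∈ E, ∃ f ∈ F, ∃ t s : Term S 4,
    (∀ q, InDisjunction q → Term.eval q t = Term.eval q s) ∧
      d = (Term.subst (σ e f) t, Term.subst (σ e f) s)}, ?_⟩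
  ext p
  constructor
  · intro hp
    by_contra hcon
    simp only [Set.mem_union, not_or, solutionSet, Set.mem_ofPred_eq, not_forall] at hcon
    obtain ⟨⟨e, he, hne⟩, f, hf, hnf⟩ := hcon
    have := h (fun i => Term.eval p (σ e f i)) fun t s hts => by
      have := hp _ ⟨e, he, f, hf, t, s, hts, rfl⟩
      simpa only [Term.eval_subst] using this
    exact this.elim hne hnf
  · rintro hp _ ⟨e, he, f, hf, t, s, hts, rfl⟩
    simp only [Term.eval_subst]
    exact hts _ (hp.imp (fun h => h e he) fun h => h f hf)

theorem SeparatesDisjunction.isEquationalDomain (h : SeparatesDisjunction S) :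
    IsEquationalDomain S := by
  intro n k
  induction k with
  | zero =>
    intro Y hY
    rw [show ⋃ i, Y i = Y 0 by ext; simp [Fin.exists_fin_one]]
    exact hY 0
  | succ k ih =>
    intro Y hY
    rw [show ⋃ i, Y i = Y 0 ∪ ⋃ i : Fin (k + 1), Y i.succ by
      ext; simp only [Set.mem_iUnion, Set.mem_union, Fin.exists_fin_succ]]
    exact h.isAlgebraicSet_union (hY 0) (ih _ fun i => hY i.succ)

theorem SeparatesDisjunction.op (h : SeparatesDisjunction S) : SeparatesDisjunction Sᵐᵒᵖ := by
  intro p hp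
  have := h (fun i => (p i).unop) fun t s hts => by
    obtain ⟨t', ht⟩ := Term.exists_eval_op t
    obtain ⟨s', hs⟩ := Term.exists_eval_op s
    have h1 := hp t' s' fun q hq => by
      have := hts (fun i => (q i).unop) (by simpa [InDisjunction] using hq)
      have e1 := ht (fun i => (q i).unop)
      have e2 := hs (fun i => (q i).unop)
      simp only [MulOpposite.op_unop] at e1 e2
      rw [e1, e2, this]
    have e1 := ht (fun i => (p i).unop)
    have e2 := hs (fun i => (p i).unop)
    simp only [MulOpposite.op_unop] at e1 e2
    rwa [e1, e2, MulOpposite.op_inj] at h1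
  simpa [InDisjunction] using this

end Terms

/-! ### Obstructions to separation -/

section Obstructions

variable {S : Type*} [Semigroup S] {n : ℕ} {K : Set S}

theorem Term.eval_mul_eq_of_forall_mul_eq (hl : ∀ a, ∀ k ∈ K, a * k ∈ K) {p q : Fin n → S}
    (hpq : ∀ i, ∀ k ∈ K, p i * k = q i * k) (t : Term S n) :
    ∀ k ∈ K, Term.eval p t * k = Term.eval q t * k := by
  induction t using FreeSemigroup.recOnMul with
  | ih1 x => cases x <;> simp_all
  | ih2 x y hx hy =>
    intro k hk
    rw [Term.eval_mul, Term.eval_mul, mul_assoc, mul_assoc, hy k hk, hx _ (hl _ _ hk)]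

/-- If the points of `P` have coordinates in the ideal `K` that multiply `K` from the left alike,
then a nonconstant term depends, on `P`, only on its last variable. -/
theorem Term.eval_eq_const_or_last_variable (hl : ∀ a, ∀ k ∈ K, a * k ∈ K)
    (hr : ∀ k ∈ K, ∀ a, k * a ∈ K) {P : Set (Fin n → S)} (hPK : ∀ p ∈ P, ∀ i, p i ∈ K)
    (hP : ∀ p ∈ P, ∀ q ∈ P, ∀ i, ∀ k ∈ K, p i * k = q i * k) (t : Term S n) :
    (∃ c, ∀ p, Term.eval p t = c) ∨ ((∀ p ∈ P, Term.eval p t ∈ K) ∧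
      ∃ i, ∀ p ∈ P, ∀ q ∈ P, p i = q i → Term.eval p t = Term.eval q t) := by
  induction t using FreeSemigroup.recOnMul with
  | ih1 x =>
    cases x with
    | inl i =>
      exact .inr ⟨fun p hp => by simpa using hPK p hp i, i, fun p _ q _ h => by simpa using h⟩
    | inr c => exact .inl ⟨c, by simp⟩
  | ih2 x y hx hy =>
    rcases hy with ⟨c, hc⟩ | ⟨hK, i, hi⟩
    · rcases hx with ⟨d, hd⟩ | ⟨hK, i, hi⟩
      · exact .inl ⟨d * c, fun p => by rw [Term.eval_mul, hc, hd]⟩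
      · refine .inr ⟨fun p hp => ?_, i, fun p hp q hq h => ?_⟩
        · rw [Term.eval_mul]
          exact hr _ (hK p hp) _
        · rw [Term.eval_mul, Term.eval_mul, hc, hc, hi p hp q hq h]
    · refine .inr ⟨fun p hp => ?_, i, fun p hp q hq h => ?_⟩
      · rw [Term.eval_mul]
        exact hl _ _ (hK p hp)
      · rw [Term.eval_mul, Term.eval_mul, hi p hp q hq h]
        exact Term.eval_mul_eq_of_forall_mul_eq hl (hP p hp q hq) _ _ (hK q hq)

/-- In an equational domain an ideal acts faithfully on itself by left multiplications. Otherwise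
choose `e ≠ f` acting alike: both sides of an equation depend on at most one coordinate of points
with entries in `{e, f}`, and `(e, f, e, f)` agrees in any two given coordinates with such a point
of `x_0 = x_1 ∨ x_2 = x_3`. -/
theorem SeparatesDisjunction.eq_of_forall_mul_eq (h : SeparatesDisjunction S)
    (hl : ∀ a, ∀ k ∈ K, a * k ∈ K) (hr : ∀ k ∈ K, ∀ a, k * a ∈ K) {e f : S} (he : e ∈ K)
    (hf : f ∈ K) (hef : ∀ k ∈ K, e * k = f * k) : e = f := by
  let P : Set (Fin 4 → S) := {p | ∀ i, p i = e ∨ p i = f}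
  have hPK : ∀ p ∈ P, ∀ i, p i ∈ K := fun p hp i => by
    rcases hp i with h | h <;> rw [h] <;> assumption
  have hP : ∀ p ∈ P, ∀ q ∈ P, ∀ i, ∀ k ∈ K, p i * k = q i * k := fun p hp q hq i k hk => by
    rcases hp i with h | h <;> rcases hq i with h' | h' <;> rw [h, h'] <;> simp [hef k hk]
  have hp : ![e, f, e, f] ∈ P := by
    intro i
    fin_cases i <;> simp
  have key : ∀ t : Term S 4, ∃ i : Fin 4, ∀ q ∈ P, q i = ![e, f, e, f] i →
      Term.eval ![e, f, e, f] t = Term.eval q t := by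
    intro t
    rcases Term.eval_eq_const_or_last_variable hl hr hPK hP t with ⟨c, hc⟩ | ⟨-, i, hi⟩
    · exact ⟨0, fun q _ _ => by rw [hc, hc]⟩
    · exact ⟨i, fun q hq hqi => hi _ hp q hq hqi.symm⟩
  have hq : ∀ i j : Fin 4, ∃ q ∈ P, InDisjunction q ∧ q i = ![e, f, e, f] i ∧
      q j = ![e, f, e, f] j := by
    have hk : ∀ i j : Fin 4, ∃ k, k ≠ i ∧ k ≠ j := by decide
    intro i j
    obtain ⟨k, hki, hkj⟩ := hk i j
    -- Changing the coordinate `k` of the point moves it into the disjunction.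
    have : ∃ x, (x = e ∨ x = f) ∧ InDisjunction (Function.update ![e, f, e, f] k x) := by
      fin_cases k
      · exact ⟨f, by simp, by simp [InDisjunction, Function.update]⟩
      · exact ⟨e, by simp, by simp [InDisjunction, Function.update]⟩
      · exact ⟨f, by simp, by simp [InDisjunction, Function.update]⟩
      · exact ⟨e, by simp, by simp [InDisjunction, Function.update]⟩
    obtain ⟨x, hx, hd⟩ := this
    refine ⟨_, fun l => ?_, hd, ?_, ?_⟩
    · rcases eq_or_ne l k with rfl | hlk
      · simpa using hx
      · rw [Function.update_of_ne hlk]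
        exact hp l
    · rw [Function.update_of_ne hki.symm]
    · rw [Function.update_of_ne hkj.symm]
  have := h ![e, f, e, f] fun t s hts => by
    obtain ⟨i, hi⟩ := key t
    obtain ⟨j, hj⟩ := key s
    obtain ⟨q, hqP, hd, hqi, hqj⟩ := hq i j
    rw [hi q hqP hqi, hj q hqP hqj, hts q hd]
  simpa [InDisjunction] using this

theorem SeparatesDisjunction.eq_of_forall_mul_eq' (h : SeparatesDisjunction S)
    (hl : ∀ a, ∀ k ∈ K, a * k ∈ K) (hr : ∀ k ∈ K, ∀ a, k * a ∈ K) {e f : S} (he : e ∈ K)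
    (hf : f ∈ K) (hef : ∀ k ∈ K, k * e = k * f) : e = f := by
  apply MulOpposite.op_injective
  refine h.op.eq_of_forall_mul_eq (K := MulOpposite.unop ⁻¹' K) (fun a k hk => ?_)
    (fun k hk a => ?_) (Set.mem_preimage.2 he) (Set.mem_preimage.2 hf) fun k hk => ?_
  · exact hr _ hk _
  · exact hl _ _ hk
  · exact MulOpposite.unop_injective (hef _ hk)

/-- The two cases are those of a term that contains the variable `x_j`, and of one that does not. -/
theorem Term.eval_mem_or_eval_eq (hl : ∀ a, ∀ k ∈ K, a * k ∈ K) (hr : ∀ k ∈ K, ∀ a, k * a ∈ K)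
    (j : Fin n) (t : Term S n) :
    (∀ p : Fin n → S, p j ∈ K → Term.eval p t ∈ K) ∨
      ∀ (p : Fin n → S) (x : S), Term.eval (Function.update p j x) t = Term.eval p t := by
  induction t using FreeSemigroup.recOnMul with
  | ih1 x =>
    cases x with
    | inl i =>
      rcases eq_or_ne i j with rfl | hij
      · exact .inl fun p hp => by simpa using hp
      · exact .inr fun p x => by simp [Function.update_of_ne hij]
    | inr c => exact .inr fun p x => by simp
  | ih2 x y hx hy =>
    rcases hx with hx | hx
    · exact .inl fun p hp => by
        rw [Term.eval_mul]
        exact hr _ (hx p hp) _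
    · rcases hy with hy | hy
      · exact .inl fun p hp => by
          rw [Term.eval_mul]
          exact hl _ _ (hy p hp)
      · exact .inr fun p z => by rw [Term.eval_mul, Term.eval_mul, hx, hy]

/-- An ideal of an equational domain that has an identity element is the whole semigroup: for
`a ∉ K` the point `(a, a * e, a, a * e)` cannot be separated from `x_0 = x_1 ∨ x_2 = x_3`, because
terms taking values outside `K` there involve neither `x_1` nor `x_3`. -/
theorem SeparatesDisjunction.mem_of_ideal_identity (h : SeparatesDisjunction S)
    (hl : ∀ a, ∀ k ∈ K, a * k ∈ K) (hr : ∀ k ∈ K, ∀ a, k * a ∈ K) {e : S} (he : e ∈ K)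
    (hel : ∀ k ∈ K, e * k = k) (her : ∀ k ∈ K, k * e = k) (a : S) : a ∈ K := by
  by_contra ha
  have hae : a * e ∈ K := hl _ _ he
  set p : Fin 4 → S := ![a, a * e, a, a * e] with hp
  have h1 : InDisjunction (Function.update p 1 a) := by simp [InDisjunction, hp]
  have h3 : InDisjunction (Function.update p 3 a) := by simp [InDisjunction, hp, Function.update]
  have hconst (t : Term S 4) : Term.eval p t * e = Term.eval (fun _ => a * e) t * e := by
    refine Term.eval_mul_eq_of_forall_mul_eq hl (fun i k hk => ?_) t e he
    fin_cases i <;> simp [hp, mul_assoc, hel k hk]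
  -- If one side of the equation takes a value outside `K`, the two values agree.
  have hout : ∀ t s : Term S 4, (∀ q, InDisjunction q → Term.eval q t = Term.eval q s) →
      Term.eval p t ∉ K → Term.eval p t = Term.eval p s := by
    intro t s hts ht
    have t1 := (Term.eval_mem_or_eval_eq hl hr 1 t).resolve_left fun hmem => ht (hmem p hae)
    have t3 := (Term.eval_mem_or_eval_eq hl hr 3 t).resolve_left fun hmem => ht (hmem p hae)
    have e1 := hts _ h1
    have e3 := hts _ h3
    rw [t1] at e1
    rw [t3] at e3
    have s1 := (Term.eval_mem_or_eval_eq hl hr 1 s).resolve_left fun hmem =>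
      ht (e3 ▸ hmem _ (by simpa [hp, Function.update] using hae))
    rw [e1, s1]
  have := h p fun t s hts => by
    by_cases ht : Term.eval p t ∈ K
    · by_cases hs : Term.eval p s ∈ K
      · rw [← her _ ht, ← her _ hs, hconst, hconst, hts _ (.inl rfl)]
      · exact (hout s t (fun q hq => (hts q hq).symm) hs).symm
    · exact hout t s hts ht
  have hne : a ≠ a * e := fun hh => ha (hh ▸ hae)
  exact this.elim hne hne

end Obstructions

/-! ### Groups of order less than sixty -/

section SmallGroups

/-- A group of order `p ^ v * m` with `d` Sylow `p`-subgroups, where `d` satisfies Sylow's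
conditions, has a normal Sylow subgroup, or a conjugation action on the Sylow subgroups that is too
small to be faithful, or self-normalizing Sylow subgroups of order `p`. -/
def SylowCountTractable (p v m : ℕ) : Prop :=
  ∀ d < m + 1, d ∣ m → d % p = 1 → d = 1 ∨ ¬ p ^ v * m ∣ d.factorial ∨ (d = m ∧ v = 1)

instance (p v m : ℕ) : Decidable (SylowCountTractable p v m) := by
  unfold SylowCountTractable
  infer_instance

theorem exists_sylowCountTractable {n : ℕ} (h1 : 1 < n) (h60 : n < 60) :
    ∃ p v m : ℕ, p.Prime ∧ 0 < v ∧ n = p ^ v * m ∧ ¬ p ∣ m ∧ SylowCountTractable p v m := by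
  have key : ∀ n < 60, 1 < n → ∃ p < 60, p ∣ n ∧ p.Prime ∧ ∃ v < 6, 0 < v ∧ p ^ v ∣ n ∧
      ¬ p ∣ n / p ^ v ∧ SylowCountTractable p v (n / p ^ v) := by
    decide +kernel
  obtain ⟨p, -, -, hp, v, -, hv, hdvd, hm, ht⟩ := key n h60 h1
  exact ⟨p, v, n / p ^ v, hp, hv, (Nat.mul_div_cancel' hdvd).symm, hm, ht⟩

/-- In each tractable case the simple group coincides with its Sylow `p`-subgroup, hence is
nilpotent; self-normalizing Sylow subgroups of order `p` have a normal complement by Burnside's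
transfer theorem. -/
theorem isSolvable_of_isSimpleGroup_of_card_lt_sixty {G : Type*} [Group G] [Finite G]
    [IsSimpleGroup G] (h60 : Nat.card G < 60) : Group.IsSolvable G := by
  obtain ⟨p, v, m, hp, hv, hn, hm, hd⟩ := exists_sylowCountTractable Finite.one_lt_card h60
  have := Fact.mk hp
  let P : Sylow p G := default
  have hm0 : m ≠ 0 := by rintro rfl; simp at hm
  have hPc : Nat.card P = p ^ v := by
    rw [P.card_eq_multiplicity, hn, Nat.factorization_mul (pow_ne_zero _ hp.ne_zero) hm0,
      Finsupp.add_apply, hp.factorization_pow, Finsupp.single_eq_same,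
      Nat.factorization_eq_zero_of_not_dvd hm, add_zero]
  have hPi : (P : Subgroup G).index = m := by
    have := (P : Subgroup G).card_mul_index
    rw [hn] at this
    exact Nat.eq_of_mul_eq_mul_left (pow_pos hp.pos v) (hPc ▸ this)
  have hPbot : (P : Subgroup G) ≠ ⊥ := fun hb => by
    have : Nat.card (P : Subgroup G) = 1 := by rw [hb]; simp
    exact (Nat.one_lt_pow hv.ne' hp.one_lt).ne' (hPc ▸ this)
  have hPtop : (P : Subgroup G) = ⊤ → Group.IsSolvable G := fun ht => by
    have : IsPGroup p G :=
      P.isPGroup'.of_equiv ((MulEquiv.subgroupCongr ht).trans Subgroup.topEquiv)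
    have := this.isNilpotent
    infer_instance
  have hone : Nat.card (Sylow p G) = 1 → Group.IsSolvable G := fun h1 => by
    have := (Nat.card_eq_one_iff_unique.1 h1).1
    have : (P : Subgroup G).Normal := P.normal_of_subsingleton
    exact hPtop (this.eq_bot_or_eq_top.resolve_left hPbot)
  have hdm : Nat.card (Sylow p G) ∣ m := hPi ▸ P.card_dvd_index
  have hmod : Nat.card (Sylow p G) % p = 1 := by
    have := card_sylow_modEq_one p G
    rwa [Nat.ModEq, Nat.mod_eq_of_lt hp.one_lt] at this
  rcases hd _ (Nat.lt_succ_of_le (Nat.le_of_dvd (Nat.pos_of_ne_zero hm0) hdm)) hdm hmod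
    with h | h | ⟨h, rfl⟩
  · exact hone h
  · let φ := MulAction.toPermHom G (Sylow p G)
    rcases (inferInstance : φ.ker.Normal).eq_bot_or_eq_top with hk | hk
    · refine absurd ?_ h
      rw [← hn, ← Nat.card_perm]
      exact Subgroup.card_dvd_of_injective φ ((MonoidHom.ker_eq_bot_iff φ).1 hk)
    · refine hone (Nat.card_eq_one_iff_unique.2 ⟨⟨fun Q R => ?_⟩, ⟨P⟩⟩)
      obtain ⟨g, rfl⟩ := MulAction.exists_smul_eq G Q R
      have hg : g ∈ φ.ker := hk ▸ Subgroup.mem_top g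
      exact (congrArg (fun π => π Q) (MonoidHom.mem_ker.1 hg)).symm
  · have hN : Subgroup.normalizer (P : Set G) = P := by
      refine (Subgroup.eq_of_le_of_card_ge Subgroup.le_normalizer ?_).symm
      have h1 := (Subgroup.normalizer (P : Set G)).card_mul_index
      rw [← P.card_eq_index_normalizer, h, ← hPi, ← (P : Subgroup G).card_mul_index] at h1
      exact (Nat.eq_of_mul_eq_mul_right (Nat.pos_of_ne_zero (hPi ▸ hm0)) h1).le
    have : IsCyclic P := isCyclic_of_prime_card (p := p) (by simpa using hPc)
    have hNC : Subgroup.normalizer (P : Set G) ≤ Subgroup.centralizer (P : Set G) := by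
      rw [hN]
      intro x hx y hy
      have := IsCyclic.isMulCommutative (α := P)
      exact congrArg Subtype.val (mul_comm' (⟨y, hy⟩ : P) ⟨x, hx⟩)
    have hc := MonoidHom.ker_transferSylow_isComplement' P hNC
    rcases (inferInstance : (MonoidHom.transferSylow P hNC).ker.Normal).eq_bot_or_eq_top
      with hk | hk
    · rw [hk, Subgroup.isComplement'_bot_left] at hc
      exact hPtop hc
    · rw [hk, Subgroup.isComplement'_top_left] at hc
      exact absurd hc hPbot

theorem isSolvable_of_card_lt_sixty (G : Type*) [Group G] [Finite G] (h60 : Nat.card G < 60) :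
    Group.IsSolvable G := by
  induction hn : Nat.card G using Nat.strong_induction_on generalizing G with
  | _ n ih =>
    subst hn
    rcases subsingleton_or_nontrivial G with hG | hG
    · infer_instance
    by_cases hs : ∀ N : Subgroup G, N.Normal → N = ⊥ ∨ N = ⊤
    · have : IsSimpleGroup G := ⟨hs⟩
      exact isSolvable_of_isSimpleGroup_of_card_lt_sixty h60
    · push Not at hs
      obtain ⟨N, hN, hb, ht⟩ := hs
      have hprod := N.card_mul_index
      have hi : 1 < N.index := Subgroup.one_lt_index_of_ne_top ht
      have hc : 1 < Nat.card N := (Subgroup.one_lt_card_iff_ne_bot N).2 hb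
      rw [Group.isSolvable_iff_subgroup_quotient N]
      have h1 : Nat.card N < Nat.card G := by nlinarith
      have h2 : Nat.card (G ⧸ N) < Nat.card G := by
        change N.index < _
        nlinarith
      exact ⟨ih _ h1 N (h1.trans h60) rfl, ih _ h2 (G ⧸ N) (h2.trans h60) rfl⟩

theorem exists_normal_abelian_of_isSolvable (G : Type*) [Group G] [Nontrivial G]
    [Group.IsSolvable G] :
    ∃ N : Subgroup G, N.Normal ∧ N ≠ ⊥ ∧ ∀ a ∈ N, ∀ b ∈ N, a * b = b * a := by
  classical
  have hex : ∃ n, derivedSeries G n = ⊥ := Group.IsSolvable.solvable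
  have hmin := Nat.find_spec hex
  have hlt : ∀ m < Nat.find hex, derivedSeries G m ≠ ⊥ := fun m hm => Nat.find_min hex hm
  cases hn : Nat.find hex with
  | zero =>
    rw [hn, derivedSeries_zero] at hmin
    exact absurd hmin.symm bot_ne_top
  | succ k =>
    rw [hn, derivedSeries_succ, Subgroup.commutator_eq_bot_iff_le_centralizer] at hmin
    exact ⟨derivedSeries G k, inferInstance, hlt k (by omega), fun a ha b hb => hmin hb a ha⟩

end SmallGroups

/-! ### Abelian normal subgroups of local subgroups -/

section LocalGroup

variable {S : Type*} [Semigroup S] {G : Type*} [Group G] {φ : G →ₙ* S}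

theorem map_mul_mul_map {s : S} {σ : G} (hσ : φ 1 * s * φ 1 = φ σ) (a b : G) :
    φ a * s * φ b = φ (a * σ * b) := by
  calc φ a * s * φ b = φ (a * 1) * s * φ (1 * b) := by rw [mul_one, one_mul]
    _ = φ a * (φ 1 * s * φ 1) * φ b := by simp only [map_mul, mul_assoc]
    _ = φ (a * σ * b) := by rw [hσ, map_mul, map_mul]

/-- On points with coordinates in an abelian normal subgroup `N` of the local group `e S e ≅ G`, a
nonconstant term is, up to constant factors at its ends, a homomorphism: constants between the
variables act on `N` by conjugation and can be moved to the left end. -/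
theorem Term.eval_eq_const_or_hom (hφ : ∀ s, ∃ γ, φ 1 * s * φ 1 = φ γ) {N : Subgroup G}
    (hN : N.Normal) (hab : ∀ a ∈ N, ∀ b ∈ N, a * b = b * a) {n : ℕ} (t : Term S n) :
    (∃ c, ∀ p, Term.eval p t = c) ∨ ∃ (l r : S) (F : (Fin n → G) → G),
      (∀ p, (∀ i, p i ∈ N) → F p ∈ N) ∧
      (∀ p q, (∀ i, p i ∈ N) → (∀ i, q i ∈ N) → F (p * q) = F p * F q) ∧
      ∀ p : Fin n → G, Term.eval (fun i => φ (p i)) t = l * φ (F p) * r := by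
  induction t using FreeSemigroup.recOnMul with
  | ih1 x =>
    cases x with
    | inl i =>
      refine .inr ⟨φ 1, φ 1, fun p => p i, fun p hp => hp i, fun p q _ _ => rfl, fun p => ?_⟩
      simp [← map_mul]
    | inr c => exact .inl ⟨c, by simp⟩
  | ih2 x y hx hy =>
    rcases hx with ⟨c, hc⟩ | ⟨l, r, F, hF, hF', ht⟩
    · rcases hy with ⟨d, hd⟩ | ⟨l, r, F, hF, hF', ht⟩
      · exact .inl ⟨c * d, fun p => by rw [Term.eval_mul, hc, hd]⟩
      · refine .inr ⟨c * l, r, F, hF, hF', fun p => ?_⟩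
        rw [Term.eval_mul, hc, ht]
        simp only [mul_assoc]
    · rcases hy with ⟨d, hd⟩ | ⟨l', r', F', hE, hE', ht'⟩
      · refine .inr ⟨l, r * d, F, hF, hF', fun p => ?_⟩
        rw [Term.eval_mul, hd, ht]
        simp only [mul_assoc]
      · obtain ⟨γ, hγ⟩ := hφ (r * l')
        have hconj : ∀ p, (∀ i, p i ∈ N) → γ⁻¹ * F p * γ ∈ N := fun p hp => by
          simpa using hN.conj_mem _ (hF p hp) γ⁻¹
        refine .inr ⟨l * φ γ, r', fun p => γ⁻¹ * F p * γ * F' p,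
          fun p hp => N.mul_mem (hconj p hp) (hE p hp), fun p q hp hq => ?_, fun p => ?_⟩
        · have := hab _ (hconj q hq) _ (hE p hp)
          calc γ⁻¹ * F (p * q) * γ * F' (p * q)
              = γ⁻¹ * F p * γ * (γ⁻¹ * F q * γ * F' p) * F' q := by
                rw [hF' p q hp hq, hE' p q hp hq]; group
            _ = _ := by rw [this]; group
        · calc Term.eval (fun i => φ (p i)) (FreeSemigroup.of x * y)
              = l * (φ (F p) * (r * l') * φ (F' p)) * r' := by
                rw [Term.eval_mul, ht, ht']; simp only [mul_assoc]
            _ = l * φ (γ * (γ⁻¹ * F p * γ * F' p)) * r' := by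
                rw [map_mul_mul_map hγ]; congr 3; group
            _ = _ := by rw [map_mul]; simp only [mul_assoc]

/-- The product formula `t(p q) = t(p) * (e t(1) e)⁻¹ * t(q)` for a nonconstant term `t` and points
`p`, `q` with coordinates in an abelian normal subgroup of the local group at `e = φ 1`. -/
theorem Term.eval_mul_eq_of_abelian (hinj : Function.Injective φ)
    (hφ : ∀ s, ∃ γ, φ 1 * s * φ 1 = φ γ) {N : Subgroup G} (hN : N.Normal)
    (hab : ∀ a ∈ N, ∀ b ∈ N, a * b = b * a) {n : ℕ} (t : Term S n) :
    (∃ c, ∀ p, Term.eval p t = c) ∨ ∀ γ, φ 1 * Term.eval (fun _ => φ 1) t * φ 1 = φ γ →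
      ∀ p q : Fin n → G, (∀ i, p i ∈ N) → (∀ i, q i ∈ N) →
        Term.eval (fun i => φ (p i * q i)) t =
          Term.eval (fun i => φ (p i)) t * φ γ⁻¹ * Term.eval (fun i => φ (q i)) t := by
  refine (Term.eval_eq_const_or_hom hφ hN hab t).imp_right ?_
  rintro ⟨l, r, F, hF, hF', ht⟩ γ hγ p q hp hq
  obtain ⟨μ, hμ⟩ := hφ l
  obtain ⟨ρ, hρ⟩ := hφ r
  have h1 : F 1 = 1 := by
    have := hF' 1 1 (fun _ => N.one_mem) (fun _ => N.one_mem)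
    rw [mul_one] at this
    exact left_eq_mul.1 this
  have hγ' : γ = μ * ρ := by
    apply hinj
    rw [← hγ, show Term.eval (fun _ => φ 1) t = l * φ 1 * r by
      have := ht 1
      rwa [h1] at this]
    calc φ 1 * (l * φ 1 * r) * φ 1 = φ 1 * l * φ 1 * r * φ 1 := by simp only [mul_assoc]
      _ = φ (μ * ρ) := by rw [hμ, map_mul_mul_map hρ, mul_one]
  have hpq := ht (p * q)
  rw [hF' p q hp hq] at hpq
  refine hpq.trans ?_
  rw [ht p, ht q]
  calc l * φ (F p * F q) * r = l * φ (F p * ρ * γ⁻¹ * μ * F q) * r := by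
        rw [hγ']; congr 3; group
    _ = l * (φ (F p) * r * φ γ⁻¹ * l * φ (F q)) * r := by
        rw [map_mul_mul_map hρ, map_mul_mul_map hμ]
    _ = _ := by simp only [mul_assoc]

/-- The point `(a, 1, a, 1)` with `1 ≠ a` in an abelian normal subgroup of the local group cannot be
separated from `x_0 = x_1 ∨ x_2 = x_3`: it is the product of `(a, 1, 1, 1)` and `(1, 1, a, 1)`, both
in that set, and the value of a term at the product is determined by its values at the factors and
at `(1, 1, 1, 1)`. -/
theorem SeparatesDisjunction.eq_bot_of_normal_abelian (h : SeparatesDisjunction S)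
    (hinj : Function.Injective φ) (hφ : ∀ s, ∃ γ, φ 1 * s * φ 1 = φ γ) {N : Subgroup G}
    (hN : N.Normal) (hab : ∀ a ∈ N, ∀ b ∈ N, a * b = b * a) : N = ⊥ := by
  rw [Subgroup.eq_bot_iff_forall]
  intro a ha
  let p : Fin 4 → G := ![a, 1, 1, 1]
  let q : Fin 4 → G := ![1, 1, a, 1]
  have hp : ∀ i, p i ∈ N := fun i => by fin_cases i <;> simp [p, ha]
  have hq : ∀ i, q i ∈ N := fun i => by fin_cases i <;> simp [q, ha]
  have := h (fun i => φ (p i * q i)) fun t s hts => by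
    have h1 := hts (fun _ => φ 1) (.inl rfl)
    have hpe := hts (fun i => φ (p i)) (.inr rfl)
    have hqe := hts (fun i => φ (q i)) (.inl rfl)
    obtain ⟨γ, hγ⟩ := hφ (Term.eval (fun _ => φ 1) t)
    -- A constant equal to the value at `1` of a nonconstant term satisfies the product formula.
    have hmixed : ∀ t s : Term S 4, (∃ c, ∀ p, Term.eval p t = c) →
        (∀ q, InDisjunction q → Term.eval q t = Term.eval q s) →
        (∀ γ, φ 1 * Term.eval (fun _ => φ 1) s * φ 1 = φ γ →
          ∀ p q : Fin 4 → G, (∀ i, p i ∈ N) → (∀ i, q i ∈ N) →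
            Term.eval (fun i => φ (p i * q i)) s =
              Term.eval (fun i => φ (p i)) s * φ γ⁻¹ * Term.eval (fun i => φ (q i)) s) →
        Term.eval (fun i => φ (p i * q i)) t = Term.eval (fun i => φ (p i * q i)) s := by
      rintro t s ⟨c, hc⟩ hts hs
      obtain ⟨γ, hγ⟩ := hφ (Term.eval (fun _ => φ 1) s)
      have e1 := hs γ hγ 1 1 (fun _ => N.one_mem) (fun _ => N.one_mem)
      simp only [Pi.one_apply, mul_one] at e1
      rw [hs γ hγ p q hp hq, ← hts (fun i => φ (p i)) (.inr rfl),
        ← hts (fun i => φ (q i)) (.inl rfl)]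
      rw [← hts (fun _ => φ 1) (.inl rfl)] at e1
      simpa only [hc] using e1
    rcases Term.eval_mul_eq_of_abelian hinj hφ hN hab t with ht | ht <;>
      rcases Term.eval_mul_eq_of_abelian hinj hφ hN hab s with hs | hs
    · obtain ⟨c, hc⟩ := ht
      obtain ⟨d, hd⟩ := hs
      rwa [hc, hd] at h1 ⊢
    · exact hmixed t s ht hts hs
    · exact (hmixed s t hs (fun q hq => (hts q hq).symm) ht).symm
    · rw [ht γ hγ p q hp hq, hs γ (h1 ▸ hγ) p q hp hq, hpe, hqe]
  simpa [InDisjunction, p, q, hinj.eq_iff] using this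

end LocalGroup

/-! ### Finite semigroups and their minimal ideals -/

section MinimalIdeal

universe u

theorem exists_minimal_ideal (S : Type*) [Semigroup S] [Finite S] [Nonempty S] :
    ∃ K : Set S, K.Nonempty ∧ (∀ a, ∀ k ∈ K, a * k ∈ K) ∧ (∀ k ∈ K, ∀ a, k * a ∈ K) ∧
      ∀ x ∈ K, ∀ y ∈ K, ∃ a b, y = a * x * b := by
  obtain ⟨K, ⟨hne, hl, hr⟩, hmin⟩ := exists_minimal_of_wellFoundedLT
    (fun K : Set S => K.Nonempty ∧ (∀ a, ∀ k ∈ K, a * k ∈ K) ∧ ∀ k ∈ K, ∀ a, k * a ∈ K)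
    ⟨Set.univ, Set.univ_nonempty, by simp, by simp⟩
  refine ⟨K, hne, hl, hr, fun x hx y hy => ?_⟩
  have hsub : K ≤ {y | ∃ a b, y = a * x * b} := by
    refine hmin ⟨⟨_, x, x, rfl⟩, ?_, ?_⟩ ?_
    · rintro a _ ⟨b, c, rfl⟩
      exact ⟨a * b, c, by simp only [mul_assoc]⟩
    · rintro _ ⟨b, c, rfl⟩ a
      exact ⟨b, c * a, by simp only [mul_assoc]⟩
    · rintro _ ⟨a, b, rfl⟩
      exact hr _ (hl _ _ hx) _
  exact hsub hy

theorem exists_idempotent_mem {S : Type*} [Semigroup S] [Finite S] {K : Set S} (hne : K.Nonempty)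
    (hl : ∀ a, ∀ k ∈ K, a * k ∈ K) : ∃ e ∈ K, e * e = e := by
  let _ : TopologicalSpace S := ⊥
  have : DiscreteTopology S := ⟨rfl⟩
  exact exists_idempotent_in_compact_subsemigroup (fun _ => continuous_of_discreteTopology) K hne
    K.toFinite.isCompact fun x _ y hy => hl x y hy

/-- The local submonoid `e S e` of an idempotent `e` of the minimal ideal of a finite semigroup is a
group. -/
theorem exists_localGroup {S : Type u} [Semigroup S] [Finite S] {K : Set S}
    (hr : ∀ k ∈ K, ∀ a, k * a ∈ K) (hmin : ∀ x ∈ K, ∀ y ∈ K, ∃ a b, y = a * x * b) {e : S}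
    (he : e ∈ K) (hee : e * e = e) :
    ∃ (G : Type u) (_ : Group G) (φ : G →ₙ* S), Function.Injective φ ∧ φ 1 = e ∧
      ∀ s, ∃ γ, e * s * e = φ γ := by
  let G := {x : S // e * x = x ∧ x * e = x}
  have hmem (s : S) : e * (e * s * e) = e * s * e ∧ e * s * e * e = e * s * e :=
    ⟨by rw [← mul_assoc, ← mul_assoc, hee], by rw [mul_assoc, hee]⟩
  let _ : Monoid G :=
    { mul := fun x y => ⟨x.1 * y.1, by rw [← mul_assoc, x.2.1], by rw [mul_assoc, y.2.2]⟩
      mul_assoc := fun x y z => Subtype.ext (mul_assoc _ _ _)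
      one := ⟨e, hee, hee⟩
      one_mul := fun x => Subtype.ext x.2.1
      mul_one := fun x => Subtype.ext x.2.2 }
  have hinv (x : G) : ∃ y : G, y * x = 1 := by
    obtain ⟨a, b, hab⟩ := hmin x.1 (x.2.1 ▸ hr _ he _) e he
    let a' : G := ⟨e * a * e, hmem a⟩
    let b' : G := ⟨e * b * e, hmem b⟩
    have h1 : a' * (x * b') = 1 := Subtype.ext <| by
      calc e * a * e * (x.1 * (e * b * e)) = e * (a * ((e * x.1) * e * b)) * e := by
            simp only [mul_assoc]
        _ = e := by rw [x.2.1, x.2.2, ← mul_assoc a, ← hab, hee, hee]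
    refine ⟨b' * a', mul_eq_one_comm.1 ?_⟩
    rw [← mul_assoc]
    exact mul_eq_one_comm.1 h1
  choose inv hinv using hinv
  let _ : Inv G := ⟨inv⟩
  exact ⟨G, { (inferInstance : Monoid G) with inv := inv, inv_mul_cancel := hinv },
    ⟨Subtype.val, fun _ _ => rfl⟩, Subtype.val_injective, rfl, fun s => ⟨⟨e * s * e, hmem s⟩, rfl⟩⟩

/-- If the minimal ideal is neither one `ℛ`-class nor one `ℒ`-class then it contains at least four
disjoint copies of its local group: `u e` lies outside the `ℛ`-class and `e v` outside the
`ℒ`-class of `e = φ 1`. -/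
theorem four_mul_card_localGroup_le {S : Type*} [Semigroup S] [Finite S] {G : Type*} [Group G]
    {φ : G →ₙ* S} (hinj : Function.Injective φ) (hφ : ∀ s, ∃ γ, φ 1 * s * φ 1 = φ γ) {u v : S}
    (hu : φ 1 * u * φ 1 ≠ u * φ 1) (hv : φ 1 * v * φ 1 ≠ φ 1 * v) :
    4 * Nat.card G ≤ Nat.card S := by
  let U : Fin 2 → S := ![φ 1, u * φ 1]
  let V : Fin 2 → S := ![φ 1, φ 1 * v]
  have h11 : φ 1 * φ 1 = φ 1 := by rw [← map_mul, mul_one]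
  have h1 (g : G) : φ 1 * φ g = φ g := by rw [← map_mul, one_mul]
  have h2 (g : G) : φ g * φ 1 = φ g := by rw [← map_mul, mul_one]
  have hU (i) : U i * φ 1 = U i := by fin_cases i <;> simp [U, mul_assoc, h11]
  have hV (i) : φ 1 * V i = V i := by fin_cases i <;> simp [V, ← mul_assoc, h11]
  have hU' (i) : ∃ α, φ 1 * U i = φ α := by
    obtain ⟨α, hα⟩ := hφ (U i)
    exact ⟨α, by rw [← hα, mul_assoc, hU]⟩
  have hV' (i) : ∃ β, V i * φ 1 = φ β := by
    obtain ⟨β, hβ⟩ := hφ (V i)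
    exact ⟨β, by rw [← hβ, hV]⟩
  choose α hα using hU'
  choose β hβ using hV'
  have key : Function.Injective fun x : Fin 2 × G × Fin 2 => U x.1 * φ x.2.1 * V x.2.2 := by
    rintro ⟨i, g, j⟩ ⟨k, h, l⟩ heq
    dsimp only at heq
    have hik : i = k := by
      -- Cancelling the two rightmost factors leaves an equation `U i * φ σ = U k`.
      have e1 : U i * φ (g * β j * (h * β l)⁻¹) = U k := by
        calc U i * φ (g * β j * (h * β l)⁻¹)
            = U i * φ g * (V j * φ 1) * φ (h * β l)⁻¹ := by
              rw [hβ]; simp only [map_mul, mul_assoc]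
          _ = U k * φ h * (V l * φ 1) * φ (h * β l)⁻¹ := by
              rw [← mul_assoc, heq, ← mul_assoc (U k * φ h)]
          _ = U k * φ (h * β l * (h * β l)⁻¹) := by
              rw [hβ]; simp only [map_mul, mul_assoc]
          _ = U k := by rw [mul_inv_cancel, hU]
      set σ := g * β j * (h * β l)⁻¹
      fin_cases i <;> fin_cases k
      · rfl
      · refine absurd ?_ hu
        simp only [U, Fin.zero_eta, Fin.mk_one, Matrix.cons_val_zero, Matrix.cons_val_one] at e1
        rw [mul_assoc, ← e1, h1, h1]
      · refine absurd ?_ hu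
        simp only [U, Fin.zero_eta, Fin.mk_one, Matrix.cons_val_zero, Matrix.cons_val_one] at e1
        have e2 : u * φ 1 = φ σ⁻¹ := by
          calc u * φ 1 = u * φ 1 * φ (σ * σ⁻¹) := by rw [mul_inv_cancel, mul_assoc, h11]
            _ = φ σ⁻¹ := by rw [map_mul, ← mul_assoc, e1, h1]
        rw [mul_assoc, e2, h1]
      · rfl
    have hjl : j = l := by
      have e1 : φ ((α k * h)⁻¹ * (α i * g)) * V j = V l := by
        calc φ ((α k * h)⁻¹ * (α i * g)) * V j
            = φ (α k * h)⁻¹ * ((φ 1 * U i) * φ g * V j) := by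
              rw [hα]; simp only [map_mul, mul_assoc]
          _ = φ (α k * h)⁻¹ * ((φ 1 * U k) * φ h * V l) := by
              rw [mul_assoc (φ 1), mul_assoc (φ 1), heq]; simp only [mul_assoc]
          _ = φ ((α k * h)⁻¹ * (α k * h)) * V l := by
              rw [hα]; simp only [map_mul, mul_assoc]
          _ = V l := by rw [inv_mul_cancel, hV]
      set σ := (α k * h)⁻¹ * (α i * g)
      fin_cases j <;> fin_cases l
      · rfl
      · refine absurd ?_ hv
        simp only [V, Fin.zero_eta, Fin.mk_one, Matrix.cons_val_zero, Matrix.cons_val_one] at e1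
        rw [← e1, h2, h2]
      · refine absurd ?_ hv
        simp only [V, Fin.zero_eta, Fin.mk_one, Matrix.cons_val_zero, Matrix.cons_val_one] at e1
        have e2 : φ 1 * v = φ σ⁻¹ := by
          calc φ 1 * v = φ (σ⁻¹ * σ) * (φ 1 * v) := by rw [inv_mul_cancel, ← mul_assoc, h11]
            _ = φ σ⁻¹ := by rw [map_mul, mul_assoc, e1, h2]
        rw [e2, h2]
      · rfl
    subst hik hjl
    have e1 : φ (α i * g * β j) = φ (α i * h * β j) := by
      calc φ (α i * g * β j) = φ 1 * (U i * φ g * V j) * φ 1 := by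
            rw [map_mul, map_mul, ← hα, ← hβ]; simp only [mul_assoc]
        _ = φ (α i * h * β j) := by
            rw [heq, map_mul, map_mul, ← hα, ← hβ]; simp only [mul_assoc]
    have := hinj e1
    simpa using this
  have := Nat.card_le_card_of_injective _ key
  simp only [Nat.card_prod, Nat.card_eq_fintype_card, Fintype.card_fin] at this
  omega

theorem SeparatesDisjunction.card_ge {S : Type*} [Semigroup S] [Finite S] [Nonempty S]
    (h : SeparatesDisjunction S) (hS : ¬ IsGroup S) : 240 ≤ Nat.card S := by
  obtain ⟨K, hne, hl, hr, hmin⟩ := exists_minimal_ideal S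
  obtain ⟨e, he, hee⟩ := exists_idempotent_mem hne hl
  obtain ⟨G, _, φ, hinj, rfl, hφ⟩ := exists_localGroup hr hmin he hee
  have hident : (∀ k ∈ K, φ 1 * k = k) → (∀ k ∈ K, k * φ 1 = k) → False := by
    intro hel her
    have hK := h.mem_of_ideal_identity hl hr he hel her
    refine hS ⟨φ 1, fun x => ⟨hel x (hK x), her x (hK x)⟩, fun x => ?_⟩
    obtain ⟨γ, hγ⟩ := hφ x
    rw [hel x (hK x), her x (hK x)] at hγ
    exact ⟨φ γ⁻¹, by rw [hγ, ← map_mul, mul_inv_cancel], by rw [hγ, ← map_mul, inv_mul_cancel]⟩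
  have hfac : ∀ k ∈ K, ∃ a b, k = a * φ 1 * (φ 1 * b) := fun k hk => by
    obtain ⟨a, b, hab⟩ := hmin _ he k hk
    exact ⟨a, b, by rw [mul_assoc, ← mul_assoc (φ 1), hee, ← mul_assoc, hab]⟩
  obtain ⟨u, hu⟩ : ∃ u, φ 1 * u * φ 1 ≠ u * φ 1 := by
    by_contra! hcon
    have hel : ∀ k ∈ K, φ 1 * k = k := fun k hk => by
      obtain ⟨a, b, rfl⟩ := hfac k hk
      rw [← mul_assoc, ← mul_assoc (φ 1), hcon]
    refine hident hel fun k hk => h.eq_of_forall_mul_eq hl hr (hl _ _ he) hk fun k' hk' => ?_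
    rw [mul_assoc, hel k' hk']
  obtain ⟨v, hv⟩ : ∃ v, φ 1 * v * φ 1 ≠ φ 1 * v := by
    by_contra! hcon
    have her : ∀ k ∈ K, k * φ 1 = k := fun k hk => by
      obtain ⟨a, b, rfl⟩ := hfac k hk
      rw [mul_assoc, hcon]
    refine hident (fun k hk => h.eq_of_forall_mul_eq' hl hr (hr _ he _) hk fun k' hk' => ?_) her
    rw [← mul_assoc, her k' hk']
  have hcard := four_mul_card_localGroup_le hinj hφ hu hv
  by_contra! hlt
  have : Finite G := Finite.of_injective φ hinj
  rcases subsingleton_or_nontrivial G with hG | hG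
  · have hall (s : S) : φ 1 * s * φ 1 = φ 1 := by
      obtain ⟨γ, hγ⟩ := hφ s
      rw [hγ, Subsingleton.elim γ 1]
    -- Over a trivial group, `e` and `e * v` act alike on the minimal ideal from the left.
    refine hv ((hall v).trans (h.eq_of_forall_mul_eq hl hr he (hr _ he _) fun k hk => ?_))
    obtain ⟨a, b, rfl⟩ := hfac k hk
    calc φ 1 * (a * φ 1 * (φ 1 * b)) = φ 1 * a * φ 1 * (φ 1 * b) := by simp only [mul_assoc]
      _ = φ 1 * (v * a) * φ 1 * (φ 1 * b) := by rw [hall, hall]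
      _ = _ := by simp only [mul_assoc]
  · have := isSolvable_of_card_lt_sixty G (by omega)
    obtain ⟨N, hN, hbot, hab⟩ := exists_normal_abelian_of_isSolvable G
    exact hbot (h.eq_bot_of_normal_abelian hinj hφ hN hab)

end MinimalIdeal

/-! ### Rees matrix semigroups over groups without zero divisors -/

section Rees

variable {G Λ I : Type*} [Group G] {P : Matrix I Λ G}

theorem ReesMatrix.mul_def (x y : ReesMatrix P) :
    x * y = ⟨x.first, x.elt * P x.second y.first * y.elt, y.second⟩ := rfl

/-- In the local group at `(l, i)`, which is finite, inverses are positive powers and so are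
given by semigroup terms. -/
theorem ReesMatrix.exists_eval_inv [Finite G] {l : Λ} {i : I} (hil : P i l = 1) {n : ℕ}
    (t : Term (ReesMatrix P) n) : ∃ t' : Term (ReesMatrix P) n, ∀ p (x : G),
      Term.eval p t = ⟨l, x, i⟩ → Term.eval p t' = ⟨l, x⁻¹, i⟩ := by
  have hpow (m : ℕ) : ∃ t' : Term (ReesMatrix P) n, ∀ p (x : G),
      Term.eval p t = ⟨l, x, i⟩ → Term.eval p t' = ⟨l, x ^ (m + 1), i⟩ := by
    induction m with
    | zero => exact ⟨t, fun p x hx => by simpa using hx⟩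
    | succ m ih =>
      obtain ⟨t', ht'⟩ := ih
      refine ⟨t' * t, fun p x hx => ?_⟩
      rw [Term.eval_mul, hx, ht' p x hx, mul_def]
      simp [hil, pow_succ]
  -- The exponent `2 * |G| - 1` is positive even for the trivial group.
  obtain ⟨t', ht'⟩ := hpow (2 * (Nat.card G - 1))
  refine ⟨t', fun p x hx => ?_⟩
  rw [ht' p x hx]
  congr
  have hpos : 0 < Nat.card G := Nat.card_pos
  rw [eq_inv_iff_mul_eq_one, ← pow_succ,
    show 2 * (Nat.card G - 1) + 1 + 1 = Nat.card G * 2 by omega, pow_mul, pow_card_eq_one', one_pow]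

/-- A Rees matrix semigroup with normalized sandwich matrix, pairwise distinct rows and columns, and
a finite group without zero divisors (no two nontrivial elements such that every conjugate of one
commutes with the other) is an equational domain. Translations into the local group at `(l, i)`
distinguish the points of the semigroup, and there `x_0 = x_1 ∨ x_2 = x_3` is expressed by
commutators of `x_0 x_1⁻¹` with the conjugates of `x_2 x_3⁻¹`. -/
theorem ReesMatrix.isEquationalDomain [Finite G] {l : Λ} {i : I} (hl : ∀ j, P j l = 1)
    (hi : ∀ m, P i m = 1) (hcol : ∀ m m', (∀ j, P j m = P j m') → m = m')
    (hrow : ∀ j j', (∀ m, P j m = P j' m) → j = j')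
    (hG : ∀ a b : G, a ≠ 1 → b ≠ 1 → ∃ h, a * (h * b * h⁻¹) ≠ h * b * h⁻¹ * a) :
    IsEquationalDomain (ReesMatrix P) := by
  apply SeparatesDisjunction.isEquationalDomain
  have hmul (x y : G) : (⟨l, x, i⟩ : ReesMatrix P) * ⟨l, y, i⟩ = ⟨l, x * y, i⟩ := by
    simp [mul_def, hl]
  have htrans (j : I) (m : Λ) (x : ReesMatrix P) :
      (⟨l, 1, j⟩ : ReesMatrix P) * x * ⟨m, 1, i⟩ = ⟨l, P j x.first * x.elt * P x.second m, i⟩ := by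
    simp [mul_def]
  have hsep (x y : ReesMatrix P) (hxy : x ≠ y) : ∃ j m,
      P j x.first * x.elt * P x.second m * (P j y.first * y.elt * P y.second m)⁻¹ ≠ 1 := by
    by_contra! hcon
    simp only [mul_inv_eq_one] at hcon
    have h0 : x.elt = y.elt := by simpa [hl, hi] using hcon i l
    refine hxy (ReesMatrix.ext (hcol _ _ fun j => ?_) h0 (hrow _ _ fun m => ?_))
    · simpa [hl, h0] using hcon j l
    · simpa [hi, h0] using hcon i m
  have hquot (a b : Fin 4) (j : I) (m : Λ) : ∃ t : Term (ReesMatrix P) 4, ∀ p,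
      Term.eval p t = ⟨l, P j (p a).first * (p a).elt * P (p a).second m *
        (P j (p b).first * (p b).elt * P (p b).second m)⁻¹, i⟩ := by
    let τ (c : Fin 4) : Term (ReesMatrix P) 4 := FreeSemigroup.of (Sum.inr ⟨l, 1, j⟩) *
      FreeSemigroup.of (Sum.inl c) * FreeSemigroup.of (Sum.inr ⟨m, 1, i⟩)
    have hτ (c : Fin 4) (p) : Term.eval p (τ c) =
        ⟨l, P j (p c).first * (p c).elt * P (p c).second m, i⟩ := by
      rw [← htrans]
      simp [τ]
    obtain ⟨t', ht'⟩ := exists_eval_inv (hl i) (τ b)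
    exact ⟨τ a * t', fun p => by rw [Term.eval_mul, hτ, ht' p _ (hτ b p), hmul]⟩
  intro p hp
  by_contra hcon
  obtain ⟨h01, h23⟩ := not_or.1 hcon
  obtain ⟨j, m, hX⟩ := hsep _ _ h01
  obtain ⟨j', m', hY⟩ := hsep _ _ h23
  obtain ⟨h, hne⟩ := hG _ _ hX hY
  obtain ⟨t, ht⟩ := hquot 0 1 j m
  obtain ⟨s, hs⟩ := hquot 2 3 j' m'
  obtain ⟨s', hs'⟩ : ∃ s' : Term (ReesMatrix P) 4, ∀ q, Term.eval q s' =
      ⟨l, h * (P j' (q 2).first * (q 2).elt * P (q 2).second m' *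
        (P j' (q 3).first * (q 3).elt * P (q 3).second m')⁻¹) * h⁻¹, i⟩ := by
    refine ⟨FreeSemigroup.of (Sum.inr ⟨l, h, i⟩) * s * FreeSemigroup.of (Sum.inr ⟨l, h⁻¹, i⟩),
      fun q => ?_⟩
    rw [← hmul, ← hmul, ← hs]
    simp
  refine hne ?_
  have := hp (t * s') (s' * t) fun q hq => by
    rw [Term.eval_mul, Term.eval_mul, ht, hs', hmul, hmul]
    rcases hq with hq | hq <;> simp [hq]
  rw [Term.eval_mul, Term.eval_mul, ht, hs', hmul, hmul] at this
  exact congrArg ReesMatrix.elt this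

/-- If `a` commutes with all conjugates of `b ≠ 1`, it centralizes the normal closure of `b`, which
is the whole group. -/
theorem exists_conj_not_commute_of_isSimpleGroup [IsSimpleGroup G] (hc : Subgroup.center G = ⊥)
    {a b : G} (ha : a ≠ 1) (hb : b ≠ 1) : ∃ h, a * (h * b * h⁻¹) ≠ h * b * h⁻¹ * a := by
  by_contra! hcon
  have htop : Subgroup.normalClosure {b} = ⊤ :=
    Subgroup.normalClosure_normal.eq_bot_or_eq_top.resolve_left fun h =>
      hb (by simpa [Subgroup.normalClosure_eq_bot_iff] using h)
  have hle : Subgroup.normalClosure {b} ≤ Subgroup.centralizer {a} := by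
    rw [Subgroup.normalClosure, Subgroup.closure_le]
    intro x hx
    obtain ⟨_, rfl, hbx⟩ := Group.mem_conjugatesOfSet_iff.1 hx
    obtain ⟨h, rfl⟩ := isConj_iff.1 hbx
    exact Subgroup.mem_centralizer_singleton_iff.2 (hcon h).symm
  refine ha (Subgroup.mem_bot.1 (hc ▸ Subgroup.mem_center_iff.2 fun x => ?_))
  have hx : x ∈ Subgroup.centralizer {a} := hle (htop ▸ Subgroup.mem_top x)
  exact Subgroup.mem_centralizer_singleton_iff.1 hx

theorem natCard_alternatingGroup_five : Nat.card (alternatingGroup (Fin 5)) = 60 := by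
  have := two_mul_nat_card_alternatingGroup (α := Fin 5)
  rw [Nat.card_perm, Nat.card_eq_fintype_card (α := Fin 5), Fintype.card_fin,
    show Nat.factorial 5 = 120 by rfl] at this
  omega

theorem isEquationalDomain_S240 {g : alternatingGroup (Fin 5)} (hg : g ≠ 1) :
    IsEquationalDomain (S240 g) := by
  have : IsSimpleGroup (alternatingGroup (Fin 5)) := alternatingGroup.isSimpleGroup (by simp)
  refine ReesMatrix.isEquationalDomain (l := 0) (i := 0) ?_ ?_ ?_ ?_ fun a b =>
    exists_conj_not_commute_of_isSimpleGroup (alternatingGroup.center_eq_bot (by simp))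
  all_goals simp [Fin.forall_fin_two, hg, hg.symm]

theorem not_isGroup_S240 (g : alternatingGroup (Fin 5)) : ¬ IsGroup (S240 g) := by
  rintro ⟨e, he, hinv⟩
  have hid (x : S240 g) (hx : x * x = x) : x = e := by
    obtain ⟨y, hy, -⟩ := hinv x
    calc x = x * (x * y) := by rw [hy, (he x).2]
      _ = e := by rw [← mul_assoc, hx, hy]
  have h0 := hid ⟨0, 1, 0⟩ (by simp [ReesMatrix.mul_def])
  have h1 := hid ⟨1, 1, 0⟩ (by simp [ReesMatrix.mul_def])
  have := congrArg ReesMatrix.first (h0.trans h1.symm)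
  simp at this

theorem mk_S240 (g : alternatingGroup (Fin 5)) : Cardinal.mk (S240 g) = 240 := by
  let f : S240 g ≃ Fin 2 × alternatingGroup (Fin 5) × Fin 2 :=
    ⟨fun x => (x.first, x.elt, x.second), fun x => ⟨x.1, x.2.1, x.2.2⟩, fun _ => rfl, fun _ => rfl⟩
  have : Finite (S240 g) := Finite.of_equiv _ f.symm
  have hcard : Nat.card (S240 g) = 240 := by
    rw [Nat.card_congr f, Nat.card_prod, Nat.card_prod, natCard_alternatingGroup_five,
      Nat.card_fin]
  rw [← Nat.cast_card, hcard]
  rfl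

end Rees

end SemigroupGeometry

theorem mainTheorem5 :
    (∀ (S : Type*) [Semigroup S] [Nonempty S],
      SemigroupGeometry.IsProperEquationalDomain S → (240 : Cardinal) ≤ Cardinal.mk S) ∧
    (∃ g : alternatingGroup (Fin 5), g ≠ 1) ∧
    (∀ g : alternatingGroup (Fin 5), g ≠ 1 →
      SemigroupGeometry.IsProperEquationalDomain (SemigroupGeometry.S240 g) ∧
        Cardinal.mk (SemigroupGeometry.S240 g) = 240) := by
  refine ⟨fun S _ _ h => ?_, exists_ne 1, fun g hg => ⟨⟨?_, ?_⟩, ?_⟩⟩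
  · rcases finite_or_infinite S with hS | hS
    · rw [← Nat.cast_card]
      exact_mod_cast h.1.separatesDisjunction.card_ge h.2
    · exact (Cardinal.natCast_lt_aleph0 (n := 240)).le.trans (Cardinal.aleph0_le_mk S)
  · exact SemigroupGeometry.isEquationalDomain_S240 hg
  · exact SemigroupGeometry.not_isGroup_S240 g
  · exact SemigroupGeometry.mk_S240 g
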